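/- There exist a finite set $P$ of points in convex position in the Euclidean plane (no point of $P$ lies in the convex hull of the other points of $P$) and a Delaunay triangulation $T$ of $P$ whose dilation is at least $1.5810$. Here a Delaunay triangulation of $P$ is a triangulation of the convex hull of $P$ with vertex set $P$ such that the circumcircle of every triangle has no point of $P$ in its interior; further points of $P$ may lie on the circumcircle, so that $P$ may have several Delaunay triangulations. The dilation of $T$ is $$\max_{p,p'\in P,\ p\neq p'} \frac{d_T(p,p')}{\|pp'\|},$$ where $d_T(p,p')$ is the length of a shortest path from $p$ to $p'$ along edges of $T$, each edge being weighted by its Euclidean length. -/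

import Mathlib

open scoped ENNReal

noncomputable section

namespace DelaunayDilation

/-- The Euclidean plane. -/
abbrev Plane : Type := EuclideanSpace ℝ (Fin 2)

/-- Every point of `P` is a vertex of the convex hull of `P`: no point of `P` lies in the
convex hull of the others. -/
def InConvexPosition (P : Finset Plane) : Prop :=
  ConvexIndependent ℝ (fun p : P => (p : Plane))

/-- `K` is a triangulation of (the convex hull of) `P`: a geometric simplicial complex whose
vertices are exactly the points of `P` and which fills the convex hull of `P`. -/
structure IsTriangulation (P : Finset Plane) (K : Geometry.SimplicialComplex ℝ Plane) : Prop where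
  vertices_eq : K.vertices = (P : Set Plane)
  space_eq : K.space = convexHull ℝ (P : Set Plane)

/-- A Delaunay triangulation of `P`: a triangulation such that the circumcircle of every triangle
has no point of `P` in its interior. Further points of `P` may lie on the circumcircle, so a
Delaunay triangulation need not be unique. -/
structure IsDelaunayTriangulation (P : Finset Plane)
    (K : Geometry.SimplicialComplex ℝ Plane) : Prop extends IsTriangulation P K where
  empty_circumcircle : ∀ t ∈ K.faces, t.card = 3 →
    ∀ C : EuclideanGeometry.Sphere Plane, (∀ v ∈ t, v ∈ C) →
      ∀ p ∈ P, C.radius ≤ dist p C.center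

/-- The graph on `P` formed by the edges (one-dimensional faces) of `K`. -/
def edgeGraph (P : Finset Plane) (K : Geometry.SimplicialComplex ℝ Plane) : SimpleGraph P where
  Adj p q := p ≠ q ∧ ∃ e ∈ K.faces, (e : Set Plane) = {(p : Plane), (q : Plane)}
  symm := ⟨fun _ _ h => ⟨h.1.symm, h.2.imp fun _ he => ⟨he.1, he.2.trans (Set.pair_comm _ _)⟩⟩⟩
  loopless := ⟨fun _ h => h.1 rfl⟩

/-- The Euclidean length of a walk: the sum of the lengths of its edges. -/
def walkLength {P : Finset Plane} {G : SimpleGraph P} {p q : P} (w : G.Walk p q) : ℝ≥0∞ :=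
  (w.darts.map fun e => edist e.fst e.snd).sum

/-- The length of a shortest path from `p` to `q` in the Euclidean graph `G`. -/
def pathDist {P : Finset Plane} (G : SimpleGraph P) (p q : P) : ℝ≥0∞ :=
  ⨅ w : G.Walk p q, walkLength w

/-- The dilation of the Euclidean graph `G`: the maximum, over all pairs of distinct vertices,
of the shortest path length divided by the Euclidean distance. -/
def dilation {P : Finset Plane} (G : SimpleGraph P) : ℝ≥0∞ :=
  ⨆ (p : P) (q : P) (_ : p ≠ q), pathDist G p q / edist p q

end DelaunayDilation

end

namespace DelaunayDilation

open Geometry Real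

/-! The vertices lie densely on the boundary of a stadium, the convex hull of two unit disks with
centres 3/10 apart. Every set of vertices on one semicircle is cocircular, and so are the four
tangency points, with circles enclosing no vertex. So a triangulation is Delaunay as soon as it
splits the polygon into the two semicircular parts and the middle rectangle; inside each piece the
diagonals are free.

They are chosen to give no shortcut between two antipodal boundary points `p = stadium 0` and `q =
stadium 711`, where `p` sits about 1 radian from the long axis. The certificate is `potential`, the
length of the boundary route from `p`: if it changes by at most the edge length along every edge,
then every path from `p` to `q` is at least as long as half the perimeter, about π + 3/10. Since
‖pq‖² is about 4.09 + 1.2 cos 1, the ratio just exceeds 1.5810. A zigzag of chords nearly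
perpendicular to the radius at `p` joins vertices of nearly equal potential. Once it reaches a
tangency point, a fan from that point fills the rest of the semicircle; the other half is treated
alike.

The tightest fan edge is the diameter between the tangency points: length 2 against a potential
difference of 452 steps, which requires 226 · `step` ≤ 1. With `step` = π/710 this reads π ≤
355/113, true and almost an equality; hence 710. The lemmas that matter are `ofReal_le_dilation`,
`mul_arcEdge_le_chord`, `ratio_mul_dist_le`, and `HasTriangulation.step_up` / `step_down`, which
grow the triangulation ear by ear. -/

/-! ### Oriented area, half-planes and triangles -/

/-- Twice the signed area of the triangle `abc`. -/
def orient (a b c : Plane) : ℝ := (b 0 - a 0) * (c 1 - a 1) - (b 1 - a 1) * (c 0 - a 0)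

theorem orient_rotate (a b c : Plane) : orient b c a = orient a b c := by
  simp only [orient]; ring

theorem orient_swap (a b c : Plane) : orient a c b = -orient a b c := by
  simp only [orient]; ring

@[simp] theorem orient_self_left (a b : Plane) : orient a b a = 0 := by
  simp only [orient]; ring

@[simp] theorem orient_self_right (a b : Plane) : orient a b b = 0 := by
  simp only [orient]; ring

theorem orient_combo (a b x y : Plane) {r s : ℝ} (h : r + s = 1) :
    orient a b (r • x + s • y) = r * orient a b x + s * orient a b y := by
  obtain rfl : s = 1 - r := by linarith
  simp only [orient, PiLp.add_apply, PiLp.smul_apply, smul_eq_mul]; ring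

theorem orient_add_orient_add_orient (a b c x : Plane) :
    orient b c x + orient c a x + orient a b x = orient a b c := by
  simp only [orient]; ring

theorem convex_orient_nonpos (a b : Plane) : Convex ℝ {x | orient a b x ≤ 0} := by
  intro x hx y hy r s hr hs h
  simp only [Set.mem_ofPred_eq] at *
  rw [orient_combo _ _ _ _ h]
  nlinarith

theorem convex_orient_nonneg (a b : Plane) : Convex ℝ {x | 0 ≤ orient a b x} := by
  intro x hx y hy r s hr hs h
  simp only [Set.mem_ofPred_eq] at *
  rw [orient_combo _ _ _ _ h]
  positivity

/-- An open half-plane together with one point of its boundary line is convex. -/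
theorem convex_orient_pos_or_eq (a b : Plane) {o : Plane} (ho : orient a b o = 0) :
    Convex ℝ {x | 0 < orient a b x ∨ x = o} := by
  intro x hx y hy r s hr hs h
  simp only [Set.mem_ofPred_eq] at *
  rw [orient_combo _ _ _ _ h]
  have key : ∀ {u v : Plane} {r s : ℝ}, 0 ≤ r → 0 ≤ s → r + s = 1 → 0 < orient a b u →
      (0 < orient a b v ∨ v = o) →
      0 < r * orient a b u + s * orient a b v ∨ r • u + s • v = o := by
    intro u v r s hr hs h hu hv
    rcases hr.eq_or_lt with rfl | hr
    · obtain rfl : s = 1 := by linarith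
      simpa using hv
    · left
      have : 0 ≤ orient a b v := by
        rcases hv with hv | rfl
        · exact hv.le
        · exact ho.ge
      positivity
  rcases hx with hx | rfl
  · exact key hr hs h hx hy
  · rcases hy with hy | rfl
    · rw [add_comm (r * _), add_comm (r • _)]
      exact key hs hr (by linarith) hy (Or.inr rfl)
    · right
      rw [← add_smul, h, one_smul]

theorem affineIndependent_of_orient_pos {a b c : Plane} (h : 0 < orient a b c) :
    AffineIndependent ℝ ((↑) : ({a, b, c} : Set Plane) → Plane) := by
  have key : AffineIndependent ℝ ![a, b, c] := by
    rw [affineIndependent_iff_not_collinear_set]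
    intro hcol
    obtain ⟨v, hv⟩ := (collinear_iff_of_mem (Set.mem_insert a _)).1 hcol
    obtain ⟨r, hr⟩ := hv b (by simp)
    obtain ⟨s, hs⟩ := hv c (by simp)
    refine h.ne' ?_
    rw [hr, hs]
    simp only [orient, vadd_eq_add, PiLp.add_apply, PiLp.smul_apply, smul_eq_mul]
    ring
  refine key.range.mono ?_
  rintro x (rfl | rfl | rfl)
  · exact ⟨0, rfl⟩
  · exact ⟨1, rfl⟩
  · exact ⟨2, rfl⟩

/-- The barycentric coordinates of `x` are the ratios of the subtriangle areas to the whole area. -/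
theorem mem_convexHull_triple {a b c x : Plane} (h : 0 < orient a b c)
    (ha : 0 ≤ orient b c x) (hb : 0 ≤ orient c a x) (hc : 0 ≤ orient a b x) :
    x ∈ convexHull ℝ {a, b, c} := by
  have hx : x = ∑ i, ![orient b c x / orient a b c, orient c a x / orient a b c,
      orient a b x / orient a b c] i • ![a, b, c] i := by
    simp only [Fin.sum_univ_three]
    ext i
    simp only [Matrix.cons_val, PiLp.add_apply, PiLp.smul_apply, smul_eq_mul]
    rw [div_mul_eq_mul_div, div_mul_eq_mul_div, div_mul_eq_mul_div, ← add_div, ← add_div,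
      eq_div_iff h.ne']
    fin_cases i <;> simp only [orient, Fin.zero_eta, Fin.mk_one, Fin.isValue] <;> ring
  rw [hx]
  refine (convex_convexHull ℝ _).sum_mem ?_ ?_ ?_
  · intro i _
    fin_cases i <;> simp <;> positivity
  · simp only [Fin.sum_univ_three, Matrix.cons_val]
    rw [← add_div, ← add_div, orient_add_orient_add_orient, div_self h.ne']
  · intro i _
    apply subset_convexHull
    fin_cases i <;> simp

/-- Since `c` is strictly off the line `ab`, a convex combination on that line gives `c` weight
zero. -/
theorem mem_convexHull_of_orient_eq_zero {s : Set Plane} {a b c x : Plane} (h : 0 < orient a b c)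
    (hs : s ⊆ {a, b}) (hx : x ∈ convexHull ℝ (insert c s)) (hx0 : orient a b x = 0) :
    x ∈ convexHull ℝ s := by
  rcases s.eq_empty_or_nonempty with rfl | hne
  · simp only [insert_empty_eq, convexHull_singleton, Set.mem_singleton_iff] at hx
    subst hx
    exact absurd hx0 h.ne'
  rw [convexHull_insert hne, convexJoin_singleton_left] at hx
  simp only [Set.mem_iUnion] at hx
  obtain ⟨z, hz, r, s', hr, hs', hrs, rfl⟩ := hx
  have hs0 : ∀ y ∈ s, orient a b y = 0 := by
    intro y hy
    rcases hs hy with rfl | rfl <;> simp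
  have h1 : 0 ≤ orient a b z :=
    convexHull_min (fun y hy => (hs0 y hy).ge) (convex_orient_nonneg a b) hz
  have hr0 : r = 0 := by
    rw [orient_combo _ _ _ _ hrs] at hx0
    by_contra hr0
    have : 0 < r := lt_of_le_of_ne hr (Ne.symm hr0)
    have : 0 < r * orient a b c + s' * orient a b z := by positivity
    linarith
  obtain rfl : s' = 1 := by linarith
  simpa [hr0] using hz

/-- If `P` lies in the part beyond the edge `ab` of the cone with apex `c` spanned by `a` and `b`,
then adding `c` enlarges the convex hull by the triangle `abc`. -/
theorem convexHull_insert_eq_union_triangle {P : Set Plane} {a b c : Plane} (ha : a ∈ P)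
    (hb : b ∈ P) (h : 0 < orient a b c) (hα : ∀ x ∈ P, 0 ≤ orient b c x)
    (hβ : ∀ x ∈ P, 0 ≤ orient c a x) (hγ : ∀ x ∈ P, orient a b x ≤ 0) :
    convexHull ℝ (insert c P) = convexHull ℝ P ∪ convexHull ℝ {a, b, c} := by
  apply Set.Subset.antisymm
  · intro y hy
    rw [convexHull_insert ⟨a, ha⟩, convexJoin_singleton_left] at hy
    simp only [Set.mem_iUnion] at hy
    obtain ⟨z, hz, r, s, hr, hs, hrs, rfl⟩ := hy
    have hzα : 0 ≤ orient b c z := convexHull_min hα (convex_orient_nonneg b c) hz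
    have hzβ : 0 ≤ orient c a z := convexHull_min hβ (convex_orient_nonneg c a) hz
    have hzγ : orient a b z ≤ 0 := convexHull_min hγ (convex_orient_nonpos a b) hz
    rcases le_or_gt 0 (orient a b (r • c + s • z)) with hy | hy
    · right
      apply mem_convexHull_triple h _ _ hy
      · rw [orient_combo _ _ _ _ hrs, orient_self_right]; simp; positivity
      · rw [orient_combo _ _ _ _ hrs, orient_self_left]; simp; positivity
    · left
      have hyγ := orient_combo a b c z hrs
      have hz' : orient a b z < 0 := by
        by_contra! h0
        have : 0 ≤ r * orient a b c + s * orient a b z := by positivity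
        linarith
      set D := orient a b c
      set g := orient a b z
      have hDg : 0 < D - g := by linarith
      have hts : -g / (D - g) + D / (D - g) = 1 := by field_simp; ring
      -- `w` is the point where the segment from `c` to `z` crosses the line `ab`; the cone
      -- conditions put it on the edge `ab`, so `y` lies between two points of the hull of `P`.
      set w := (-g / (D - g)) • c + (D / (D - g)) • z with hw
      have hwγ : orient a b w = 0 := by
        rw [orient_combo _ _ _ _ hts]
        field_simp
        ring
      have h1 : 0 ≤ -g / (D - g) := div_nonneg (by linarith) hDg.le
      have h2 : 0 ≤ D / (D - g) := by positivity
      have hwP : w ∈ convexHull ℝ P := by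
        refine convexHull_mono (s := {a, b}) ?_
          (mem_convexHull_of_orient_eq_zero (s := {a, b}) h subset_rfl ?_ hwγ)
        · rintro x (rfl | rfl) <;> assumption
        · have : w ∈ convexHull ℝ {a, b, c} := by
            apply mem_convexHull_triple h _ _ hwγ.ge
            · rw [orient_combo _ _ _ _ hts, orient_self_right]; simp; positivity
            · rw [orient_combo _ _ _ _ hts, orient_self_left]; simp; positivity
          refine convexHull_mono ?_ this
          rintro x (rfl | rfl | rfl) <;> simp
      have hle : r * (D - g) ≤ -g := by
        obtain rfl : s = 1 - r := by linarith
        nlinarith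
      have hcomb : r • c + s • z
          = (r * (D - g) / -g) • w + (1 - r * (D - g) / -g) • z := by
        obtain rfl : s = 1 - r := by linarith
        ext i
        simp only [hw, PiLp.add_apply, PiLp.smul_apply, smul_eq_mul]
        have : g ≠ 0 := hz'.ne
        field_simp
        ring
      rw [hcomb]
      have hg : 0 < -g := by linarith
      refine convex_convexHull ℝ P hwP hz (by positivity) ?_ (by ring)
      rw [sub_nonneg, div_le_one hg]
      exact hle
  · apply Set.union_subset
    · exact convexHull_mono (Set.subset_insert _ _)
    · apply convexHull_mono
      rintro x (rfl | rfl | rfl) <;> simp [ha, hb]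

/-! ### Growing a simplicial complex by one triangle -/

/-- The complex obtained from `K` by attaching the triangle `abc` along the edge `ab`. -/
def attachTriangle (K : SimplicialComplex ℝ Plane) (a b c : Plane) (h : 0 < orient a b c)
    (hab : {a, b} ∈ K.faces) (hK : ∀ x ∈ K.vertices, orient a b x ≤ 0) :
    SimplicialComplex ℝ Plane where
  faces := K.faces ∪ {u | c ∈ u ∧ u ⊆ {a, b, c}}
  isRelLowerSet_faces := by
    rintro u (hu | ⟨hcu, hu⟩)
    · refine ⟨K.nonempty_of_mem_faces hu, fun t ht hne => Or.inl (K.down_closed hu ht hne)⟩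
    · refine ⟨⟨c, hcu⟩, fun t ht hne => ?_⟩
      by_cases hct : c ∈ t
      · exact Or.inr ⟨hct, ht.trans hu⟩
      · refine Or.inl (K.down_closed hab (fun x hx => ?_) hne)
        have := hu (ht hx)
        simp only [Finset.mem_insert, Finset.mem_singleton] at this ⊢
        rcases this with h | h | rfl
        · exact Or.inl h
        · exact Or.inr h
        · exact absurd hx hct
  indep := by
    rintro u (hu | ⟨hcu, hu⟩)
    · exact K.indep hu
    · exact (affineIndependent_of_orient_pos h).mono (fun x hx => by simpa using hu hx)
  inter_subset_convexHull := by
    have key : ∀ {u t : Finset Plane}, c ∈ u → u ⊆ {a, b, c} → t ∈ K.faces →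
        convexHull ℝ (u : Set Plane) ∩ convexHull ℝ t ⊆ convexHull ℝ (u ∩ t : Set Plane) := by
      rintro u t hcu hu ht y ⟨hyu, hyt⟩
      have hle : orient a b y ≤ 0 := by
        refine convexHull_min (fun x hx => hK x ?_) (convex_orient_nonpos a b) hyt
        exact K.down_closed ht (by simpa using hx) (Finset.singleton_nonempty x)
      have hge : 0 ≤ orient a b y := by
        refine convexHull_min (fun x hx => ?_) (convex_orient_nonneg a b) hyu
        have := hu hx
        simp only [Finset.mem_insert, Finset.mem_singleton] at this
        rcases this with rfl | rfl | rfl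
        · simp
        · simp
        · exact h.le
      have hsub : (u.erase c : Finset Plane) ⊆ {a, b} := by
        intro x hx
        rw [Finset.mem_erase] at hx
        have := hu hx.2
        simp only [Finset.mem_insert, Finset.mem_singleton] at this ⊢
        tauto
      -- The old face and the new one lie on opposite sides of `ab`, so a common point is on the
      -- line `ab` and `c` can be dropped; what remains is a face of `K`.
      have hy : y ∈ convexHull ℝ ((u.erase c : Finset Plane) : Set Plane) := by
        refine mem_convexHull_of_orient_eq_zero h ?_ ?_ (le_antisymm hle hge)
        · intro x hx
          simpa using hsub hx
        · rwa [← Finset.coe_insert, Finset.insert_erase hcu]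
      have hne : (u.erase c).Nonempty := by
        rw [← Finset.coe_nonempty, ← convexHull_nonempty_iff (𝕜 := ℝ)]
        exact ⟨y, hy⟩
      refine convexHull_mono ?_
        (K.inter_subset_convexHull (K.down_closed hab hsub hne) ht ⟨hy, hyt⟩)
      exact Set.inter_subset_inter_left _ (by exact_mod_cast Finset.erase_subset _ _)
    rintro u t (hu | ⟨hcu, hu⟩) (ht | ⟨hct, ht⟩)
    · exact K.inter_subset_convexHull hu ht
    · rw [Set.inter_comm, Set.inter_comm (u : Set Plane)]
      exact key hct ht hu
    · exact key hcu hu ht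
    · have hi : AffineIndependent ℝ ((↑) : ({a, b, c} : Finset Plane) → Plane) :=
        (affineIndependent_of_orient_pos h).mono (fun x hx => by simpa using hx)
      exact (hi.convexHull_inter hu ht).ge

theorem mem_attachTriangle_faces {K : SimplicialComplex ℝ Plane} {a b c : Plane}
    {h : 0 < orient a b c} {hab : {a, b} ∈ K.faces} {hK : ∀ x ∈ K.vertices, orient a b x ≤ 0}
    {u : Finset Plane} : u ∈ (attachTriangle K a b c h hab hK).faces ↔
      u ∈ K.faces ∨ (c ∈ u ∧ u ⊆ {a, b, c}) := Iff.rfl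

theorem IsTriangulation.attachTriangle {P : Finset Plane} {K : SimplicialComplex ℝ Plane}
    (hP : IsTriangulation P K) {a b c : Plane}
    (h : 0 < orient a b c) (hab : {a, b} ∈ K.faces) (hK : ∀ x ∈ K.vertices, orient a b x ≤ 0)
    (hα : ∀ x ∈ P, 0 ≤ orient b c x) (hβ : ∀ x ∈ P, 0 ≤ orient c a x) :
    IsTriangulation (insert c P) (attachTriangle K a b c h hab hK) := by
  have haP : a ∈ P := by
    have : a ∈ K.vertices := K.down_closed hab (by simp) (Finset.singleton_nonempty a)
    rwa [hP.vertices_eq] at this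
  have hbP : b ∈ P := by
    have : b ∈ K.vertices := K.down_closed hab (by simp) (Finset.singleton_nonempty b)
    rwa [hP.vertices_eq] at this
  constructor
  · ext x
    rw [SimplicialComplex.mem_vertices, mem_attachTriangle_faces,
      ← SimplicialComplex.mem_vertices, hP.vertices_eq, Finset.coe_insert, Set.mem_insert_iff]
    simp only [Finset.mem_singleton]
    constructor
    · rintro (h | ⟨rfl, -⟩)
      · exact Or.inr h
      · exact Or.inl rfl
    · rintro (rfl | h)
      · exact Or.inr ⟨rfl, by simp⟩
      · exact Or.inl h
  · rw [Finset.coe_insert, convexHull_insert_eq_union_triangle (P := (P : Set Plane)) haP hbP h hα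
      hβ (fun x hx => hK x (by rwa [hP.vertices_eq])), ← hP.space_eq]
    apply Set.Subset.antisymm
    · intro x hx
      obtain ⟨u, hu | ⟨-, hu⟩, hxu⟩ := SimplicialComplex.mem_space_iff.1 hx
      · exact Or.inl (SimplicialComplex.mem_space_iff.2 ⟨u, hu, hxu⟩)
      · exact Or.inr (convexHull_mono (fun y hy => by simpa using hu hy) hxu)
    · rintro x (hx | hx)
      · obtain ⟨u, hu, hxu⟩ := SimplicialComplex.mem_space_iff.1 hx
        exact SimplicialComplex.mem_space_iff.2 ⟨u, Or.inl hu, hxu⟩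
      · exact SimplicialComplex.mem_space_iff.2 ⟨{a, b, c}, Or.inr ⟨by simp, subset_rfl⟩,
          by simpa using hx⟩

/-- The complex consisting of the segment `ab` and its endpoints. -/
def segmentComplex (a b : Plane) (h : a ≠ b) : SimplicialComplex ℝ Plane where
  faces := {u | u.Nonempty ∧ u ⊆ {a, b}}
  isRelLowerSet_faces := fun _ hu => ⟨hu.1, fun _ ht hne => ⟨hne, ht.trans hu.2⟩⟩
  indep := by
    rintro u ⟨-, hu⟩
    have := (affineIndependent_of_ne ℝ h).range
    exact this.mono (fun x hx => by simpa [eq_comm, or_comm] using hu hx)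
  inter_subset_convexHull := by
    rintro u t ⟨-, hu⟩ ⟨-, ht⟩
    have := (affineIndependent_of_ne ℝ h).range
    have hi : AffineIndependent ℝ ((↑) : ({a, b} : Finset Plane) → Plane) :=
      this.mono (fun x hx => by simpa [eq_comm, or_comm] using hx)
    exact (hi.convexHull_inter hu ht).ge

theorem isTriangulation_segmentComplex (a b : Plane) (h : a ≠ b) :
    IsTriangulation {a, b} (segmentComplex a b h) := by
  constructor
  · ext x
    simp [SimplicialComplex.mem_vertices, segmentComplex]
  · apply Set.Subset.antisymm
    · intro x hx
      obtain ⟨u, ⟨-, hu⟩, hxu⟩ := SimplicialComplex.mem_space_iff.1 hx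
      exact convexHull_mono (by exact_mod_cast hu) hxu
    · intro x hx
      exact SimplicialComplex.mem_space_iff.2 ⟨{a, b}, ⟨by simp, subset_rfl⟩, hx⟩

/-! ### Convex chains and their triangulations by adding ears -/

/-- The points `z A, …, z B` are, in this order, the vertices of a strictly convex polygon,
traversed counterclockwise. -/
def IsConvexChain (z : ℤ → Plane) (A B : ℤ) : Prop :=
  ∀ i j k, A ≤ i → i < j → j < k → k ≤ B → 0 < orient (z i) (z j) (z k)

theorem IsConvexChain.injOn {z : ℤ → Plane} {A B : ℤ} (hz : IsConvexChain z A B)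
    (hAB : A + 2 ≤ B) : Set.InjOn z (Set.Icc A B) := by
  have key : ∀ i j, A ≤ i → i < j → j ≤ B → z i ≠ z j := by
    intro i j hi hij hj h
    rcases eq_or_lt_of_le hi with rfl | hi'
    · rcases eq_or_lt_of_le hj with rfl | hj'
      · have := hz A (A + 1) j le_rfl (by lia) (by lia) le_rfl
        simp [h] at this
      · have := hz A j (j + 1) le_rfl hij (by lia) hj'
        rw [h, ← orient_rotate] at this
        simp at this
    · have := hz A i j le_rfl hi' hij hj
      simp [h] at this
  intro i hi j hj h
  rcases lt_trichotomy i j with hij | hij | hij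
  · exact absurd h (key i j hi.1 hij hj.2)
  · exact hij
  · exact absurd h.symm (key j i hj.1 hij hi.2)

/-- The line of a polygon edge at `z k` has all vertices strictly on one side except its two ends.
The remaining end is why the half-plane needs one boundary point. The edge to the predecessor
serves, except at `A`, which has none in the chain. -/
theorem IsConvexChain.inConvexPosition {z : ℤ → Plane} {A B : ℤ} (hz : IsConvexChain z A B)
    (hAB : A + 2 ≤ B) : InConvexPosition ((Finset.Icc A B).image z) := by
  have hinj := hz.injOn hAB
  refine convexIndependent_set_iff_notMem_convexHull_sdiff (s := (((Finset.Icc A B).image z :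
    Finset Plane) : Set Plane)).2 ?_
  intro x hx hmem
  simp only [Finset.coe_image, Finset.coe_Icc] at hx hmem
  obtain ⟨k, hk, rfl⟩ := hx
  -- a supporting line through `z k` and a neighbouring vertex
  have key : ∀ a b o, orient a b o = 0 → orient a b (z k) = 0 → z k ≠ o →
      (∀ i ∈ Set.Icc A B, i ≠ k → 0 < orient a b (z i) ∨ z i = o) → False := by
    intro a b o ho hk0 hne hall
    have := convexHull_min (t := {x | 0 < orient a b x ∨ x = o}) ?_
      (convex_orient_pos_or_eq a b ho) hmem
    · rcases this with h | h
      · linarith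
      · exact hne h
    · rintro _ ⟨⟨i, hi, rfl⟩, hik⟩
      exact hall i hi (fun h => hik (by simp [h]))
  rcases eq_or_lt_of_le hk.1 with rfl | hAk
  · refine key (z A) (z (A + 1)) (z (A + 1)) (by simp) (by simp) (fun h => ?_) ?_
    · have := hinj hk ⟨by lia, by lia⟩ h
      lia
    · intro i hi hik
      rcases eq_or_ne i (A + 1) with rfl | hi1
      · exact Or.inr rfl
      · have := hi.1
        exact Or.inl (hz A (A + 1) i le_rfl (by lia) (by lia) hi.2)
  · refine key (z (k - 1)) (z k) (z (k - 1)) (by simp) (by simp) (fun h => ?_) ?_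
    · have hkB := hk.2
      have := hinj hk ⟨by lia, by lia⟩ h
      lia
    · intro i hi hik
      rcases lt_trichotomy i (k - 1) with h | rfl | h
      · left
        rw [orient_rotate]
        exact hz i (k - 1) k hi.1 h (by lia) hk.2
      · exact Or.inr rfl
      · exact Or.inl (hz (k - 1) k i (by lia) (by lia) (by lia) hi.2)

/-- The vertices `z l, …, z u` have a triangulation containing the edge from `z l` to `z u`, all
of whose faces satisfy `Q`. -/
def HasTriangulation (z : ℤ → Plane) (Q : Finset Plane → Prop) (l u : ℤ) : Prop :=
  ∃ K, IsTriangulation ((Finset.Icc l u).image z) K ∧ {z l, z u} ∈ K.faces ∧ ∀ t ∈ K.faces, Q t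

section HasTriangulation

variable {z : ℤ → Plane} {Q : Finset Plane → Prop} {A B l u : ℤ}

theorem HasTriangulation.of_edge (hQ : ∀ s t, s ⊆ t → Q t → Q s) (hl : z l ≠ z (l + 1))
    (h : Q {z l, z (l + 1)}) : HasTriangulation z Q l (l + 1) := by
  refine ⟨segmentComplex _ _ hl, ?_, ⟨by simp, subset_rfl⟩, fun t ht => hQ _ _ ht.2 h⟩
  have : Finset.Icc l (l + 1) = {l, l + 1} := by
    ext x
    simp only [Finset.mem_Icc, Finset.mem_insert, Finset.mem_singleton]
    lia
  rw [this, Finset.image_insert, Finset.image_singleton]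
  exact isTriangulation_segmentComplex _ _ hl

theorem IsConvexChain.orient_nonneg (hz : IsConvexChain z A B) {i j k : ℤ} (hi : A ≤ i)
    (hij : i ≤ j) (hjk : j ≤ k) (hk : k ≤ B) : 0 ≤ orient (z i) (z j) (z k) := by
  rcases hij.eq_or_lt with rfl | hij
  · rw [← orient_rotate]; simp
  rcases hjk.eq_or_lt with rfl | hjk
  · simp
  exact (hz i j k hi hij hjk hk).le

/-- The ear is glued along the closing chord from `z l` to `z u`, and its side from `z l` to `z (u +
1)` becomes the next closing chord, so steps at either end can be iterated in any order. -/
theorem HasTriangulation.step_up (hQ : ∀ s t, s ⊆ t → Q t → Q s) (hz : IsConvexChain z A B)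
    (h : HasTriangulation z Q l u) (hl : A ≤ l) (hlu : l < u) (hu : u + 1 ≤ B)
    (hq : Q {z l, z u, z (u + 1)}) : HasTriangulation z Q l (u + 1) := by
  obtain ⟨K, hK, he, hKQ⟩ := h
  have hpos := hz l u (u + 1) hl hlu (by lia) hu
  have hneg : ∀ x ∈ K.vertices, orient (z l) (z u) x ≤ 0 := by
    intro x hx
    rw [hK.vertices_eq] at hx
    simp only [Finset.coe_image, Finset.coe_Icc] at hx
    obtain ⟨k, hk, rfl⟩ := hx
    rw [orient_swap, neg_nonpos]
    exact hz.orient_nonneg hl hk.1 hk.2 (by lia)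
  refine ⟨attachTriangle K _ _ _ hpos he hneg, ?_, ?_, ?_⟩
  · have : Finset.Icc l (u + 1) = insert (u + 1) (Finset.Icc l u) := by
      ext x
      simp only [Finset.mem_Icc, Finset.mem_insert]
      lia
    rw [this, Finset.image_insert]
    refine hK.attachTriangle hpos he hneg ?_ ?_ <;> intro x hx <;>
      obtain ⟨k, hk, rfl⟩ := Finset.mem_image.1 hx <;> rw [Finset.mem_Icc] at hk
    · rw [orient_rotate]
      exact hz.orient_nonneg (by lia) hk.2 (by lia) hu
    · rw [← orient_rotate]
      exact hz.orient_nonneg hl hk.1 (by lia) hu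
  · refine Or.inr ⟨by simp, ?_⟩
    intro x hx
    simp only [Finset.mem_insert, Finset.mem_singleton] at hx ⊢
    tauto
  · rintro t (ht | ⟨-, ht⟩)
    · exact hKQ t ht
    · exact hQ _ _ ht hq

theorem HasTriangulation.step_down (hQ : ∀ s t, s ⊆ t → Q t → Q s) (hz : IsConvexChain z A B)
    (h : HasTriangulation z Q l u) (hl : A ≤ l - 1) (hlu : l < u) (hu : u ≤ B)
    (hq : Q {z l, z u, z (l - 1)}) : HasTriangulation z Q (l - 1) u := by
  obtain ⟨K, hK, he, hKQ⟩ := h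
  have hpos : 0 < orient (z l) (z u) (z (l - 1)) := by
    rw [orient_rotate]
    exact hz (l - 1) l u hl (by lia) hlu hu
  have hneg : ∀ x ∈ K.vertices, orient (z l) (z u) x ≤ 0 := by
    intro x hx
    rw [hK.vertices_eq] at hx
    simp only [Finset.coe_image, Finset.coe_Icc] at hx
    obtain ⟨k, hk, rfl⟩ := hx
    rw [orient_swap, neg_nonpos]
    exact hz.orient_nonneg (by lia) hk.1 hk.2 (by lia)
  refine ⟨attachTriangle K _ _ _ hpos he hneg, ?_, ?_, ?_⟩
  · have : Finset.Icc (l - 1) u = insert (l - 1) (Finset.Icc l u) := by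
      ext x
      simp only [Finset.mem_Icc, Finset.mem_insert]
      lia
    rw [this, Finset.image_insert]
    refine hK.attachTriangle hpos he hneg ?_ ?_ <;> intro x hx <;>
      obtain ⟨k, hk, rfl⟩ := Finset.mem_image.1 hx <;> rw [Finset.mem_Icc] at hk
    · rw [← orient_rotate]
      exact hz.orient_nonneg hl (by lia) hk.2 hu
    · exact hz.orient_nonneg hl (by lia) hk.1 (by lia)
  · refine Or.inr ⟨by simp, ?_⟩
    intro x hx
    simp only [Finset.mem_insert, Finset.mem_singleton] at hx ⊢
    tauto
  · rintro t (ht | ⟨-, ht⟩)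
    · exact hKQ t ht
    · exact hQ _ _ ht hq

end HasTriangulation

/-! ### Criteria for the Delaunay property and for large dilation -/

theorem dist_sq (x y : Plane) : dist x y ^ 2 = (x 0 - y 0) ^ 2 + (x 1 - y 1) ^ 2 := by
  rw [EuclideanSpace.dist_eq, Real.sq_sqrt (by positivity)]
  simp [Real.dist_eq, sq_abs]

/-- A triangulation is Delaunay as soon as every face lies on some circle enclosing no point. -/
theorem IsTriangulation.isDelaunayTriangulation {P : Finset Plane}
    {K : SimplicialComplex ℝ Plane} (hK : IsTriangulation P K)
    (h : ∀ t ∈ K.faces, ∃ S : EuclideanGeometry.Sphere Plane, (∀ v ∈ t, v ∈ S) ∧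
      ∀ p ∈ P, S.radius ≤ dist p S.center) : IsDelaunayTriangulation P K := by
  refine ⟨hK, fun t ht hcard C hC => ?_⟩
  obtain ⟨S, hS, hP⟩ := h t ht
  -- Three distinct points of the plane lie on only one circle.
  suffices C = S by rwa [this]
  by_contra hne
  obtain ⟨a, b, c, hab, hac, hbc, rfl⟩ := Finset.card_eq_three.1 hcard
  have := EuclideanGeometry.eq_of_mem_sphere_of_mem_sphere_of_finrank_eq_two
    (by simp) hne hab (hC a (by simp)) (hC b (by simp)) (hC c (by simp))
    (hS a (by simp)) (hS b (by simp)) (hS c (by simp))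
  rcases this with rfl | rfl
  · exact hac rfl
  · exact hbc rfl

/-- The increments of `f` telescope along the walk; truncation at 0 by `ENNReal.ofReal` is harmless
because it is subadditive. -/
theorem ofReal_sub_le_walkLength {P : Finset Plane} {G : SimpleGraph P} {f : P → ℝ}
    (hf : ∀ x y, G.Adj x y → f y - f x ≤ dist x y) {p q : P} (w : G.Walk p q) :
    ENNReal.ofReal (f q - f p) ≤ walkLength w := by
  induction w with
  | nil => simp
  | @cons x y q hxy w ih =>
    have : walkLength (SimpleGraph.Walk.cons hxy w) = edist x y + walkLength w := by
      simp [walkLength]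
    rw [this, edist_dist]
    calc ENNReal.ofReal (f q - f x) = ENNReal.ofReal ((f y - f x) + (f q - f y)) := by congr 1; ring
      _ ≤ ENNReal.ofReal (f y - f x) + ENNReal.ofReal (f q - f y) := ENNReal.ofReal_add_le
      _ ≤ _ := by gcongr; exact hf x y hxy

/-- A function on the vertices that changes by at most the edge length along every edge bounds
the dilation from below. -/
theorem ofReal_le_dilation {P : Finset Plane} {G : SimpleGraph P} {f : P → ℝ}
    (hf : ∀ x y, G.Adj x y → f y - f x ≤ dist x y) {p q : P} (hpq : p ≠ q) {r : ℝ} (hr : 0 ≤ r)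
    (h : r * dist p q ≤ f q - f p) : ENNReal.ofReal r ≤ dilation G := by
  refine le_trans ?_ (le_iSup₂_of_le p q (le_iSup_of_le hpq le_rfl))
  rw [ENNReal.le_div_iff_mul_le (Or.inl (edist_pos.2 hpq).ne') (Or.inl (edist_ne_top _ _)),
    edist_dist, ← ENNReal.ofReal_mul hr]
  exact le_iInf fun w => (ENNReal.ofReal_le_ofReal h).trans (ofReal_sub_le_walkLength hf w)

/-! ### Trigonometry of equally spaced points on a circle -/

/-- The angle between consecutive points on the two semicircles. -/
noncomputable def step : ℝ := π / 710

/-- The point at angle `k * step` on the unit circle with centre `(c, 0)`. -/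
noncomputable def circlePoint (c : ℝ) (k : ℤ) : Plane := !₂[c + cos (k * step), sin (k * step)]

@[simp] theorem circlePoint_zero (c : ℝ) (k : ℤ) : circlePoint c k 0 = c + cos (k * step) := rfl

@[simp] theorem circlePoint_one (c : ℝ) (k : ℤ) : circlePoint c k 1 = sin (k * step) := rfl

theorem step_pos : 0 < step := by unfold step; positivity

theorem pi_eq_mul_step : π = 710 * step := by unfold step; ring

theorem sin_add_sin_sub_sin (u v : ℝ) :
    sin (2 * u) + sin (2 * v) - sin (2 * (u + v)) = 4 * sin u * sin v * sin (u + v) := by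
  rw [sin_two_mul, sin_two_mul, sin_two_mul, sin_add, cos_add]
  linear_combination (-2 * sin u * cos u) * sin_sq_add_cos_sq v
    + (-2 * sin v * cos v) * sin_sq_add_cos_sq u

/-- The triple product is the value for concentric points; the other terms account for the shifts of
the centres and cancel when these agree. -/
theorem orient_circlePoint (a b c : ℝ) (i j k : ℤ) :
    orient (circlePoint a i) (circlePoint b j) (circlePoint c k) =
      4 * sin ((j - i) * step / 2) * sin ((k - j) * step / 2) * sin ((k - i) * step / 2)
      + a * (sin (j * step) - sin (k * step)) + b * (sin (k * step) - sin (i * step))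
      + c * (sin (i * step) - sin (j * step)) := by
  have h := sin_add_sin_sub_sin ((j - i) * step / 2) ((k - j) * step / 2)
  have e1 : (2 : ℝ) * ((j - i) * step / 2) = j * step - i * step := by ring
  have e2 : (2 : ℝ) * ((k - j) * step / 2) = k * step - j * step := by ring
  have e3 : (j - i) * step / 2 + (k - j) * step / 2 = (k - i) * step / 2 := by ring
  have e4 : (2 : ℝ) * ((k - i) * step / 2) = k * step - i * step := by ring
  rw [e3, e1, e2, e4, sin_sub, sin_sub, sin_sub] at h
  rw [← h]
  simp only [orient, circlePoint_zero, circlePoint_one]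
  ring

theorem sin_half_pos {n : ℤ} (h0 : 0 < n) (h1 : n < 1420) : 0 < sin (n * step / 2) := by
  have hs := step_pos
  have h0' : (0 : ℝ) < n := by exact_mod_cast h0
  have h1' : (n : ℝ) < 1420 := by exact_mod_cast h1
  apply sin_pos_of_pos_of_lt_pi
  · positivity
  · rw [pi_eq_mul_step]; nlinarith

theorem sin_half_nonneg {n : ℤ} (h0 : 0 ≤ n) (h1 : n < 1420) : 0 ≤ sin (n * step / 2) := by
  rcases h0.eq_or_lt with rfl | h0
  · simp
  · exact (sin_half_pos h0 h1).le

theorem sin_step_lt_of_left {i j : ℤ} (hi : 355 ≤ i) (hij : i < j) (hj : j ≤ 1065) :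
    sin (j * step) < sin (i * step) := by
  have hs := step_pos
  have hi' : (355 : ℝ) ≤ i := by exact_mod_cast hi
  have hij' : (i : ℝ) < j := by exact_mod_cast hij
  have hj' : (j : ℝ) ≤ 1065 := by exact_mod_cast hj
  rw [← cos_sub_pi_div_two, ← cos_sub_pi_div_two]
  apply strictAntiOn_cos <;> (try constructor) <;> rw [pi_eq_mul_step] <;> nlinarith

theorem sin_step_lt_of_right {i j : ℤ} (hi : -355 ≤ i) (hij : i < j) (hj : j ≤ 355) :
    sin (i * step) < sin (j * step) := by
  have hs := step_pos
  have hi' : (-355 : ℝ) ≤ i := by exact_mod_cast hi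
  have hij' : (i : ℝ) < j := by exact_mod_cast hij
  have hj' : (j : ℝ) ≤ 355 := by exact_mod_cast hj
  apply strictMonoOn_sin <;> (try constructor) <;> (try rw [pi_eq_mul_step]) <;> nlinarith

theorem sin_sub_turn (i : ℤ) : sin ((i - 1420 : ℤ) * step) = sin (i * step) := by
  rw [← sin_sub_two_pi (i * step), pi_eq_mul_step]
  congr 1
  push_cast
  ring

theorem cos_sub_turn (i : ℤ) : cos ((i - 1420 : ℤ) * step) = cos (i * step) := by
  rw [← cos_sub_two_pi (i * step), pi_eq_mul_step]
  congr 1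
  push_cast
  ring

/-! ### The stadium and its convexity -/

/-- The vertices lie on the boundary of a stadium, the convex hull of two unit disks whose centres
are at distance `3 / 10`. The vertices `-129, …, 581` form the left semicircle. -/
def IsLeft (i : ℤ) : Prop := -129 ≤ i ∧ i ≤ 581

instance (i : ℤ) : Decidable (IsLeft i) := inferInstanceAs (Decidable (_ ∧ _))

/-- The angle of the `i`-th vertex of the stadium, as a multiple of `step`. -/
def angleIndex (i : ℤ) : ℤ := if i ≤ -130 then i + 485 else if i ≤ 581 then i + 484 else i + 483

/-- The abscissa of the centre of the semicircle through the `i`-th vertex of the stadium. -/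
noncomputable def centerX (i : ℤ) : ℝ := if IsLeft i then -(3 / 20) else 3 / 20

/-- The `i`-th vertex of the stadium. -/
noncomputable def stadium (i : ℤ) : Plane := circlePoint (centerX i) (angleIndex i)

/-- For three vertices on one semicircle the triple product of sines is positive. Otherwise it may
vanish, since angle indices 355 and 1065 each occur on both semicircles; positivity then comes from
the shift term, 3/10 times a difference of heights of two vertices on the same semicircle, where
height is strictly monotone. -/
theorem isConvexChain_stadium : IsConvexChain stadium (-710) 711 := by
  intro i j k hi hij hjk hk
  have hge := mul_nonneg (mul_nonneg (mul_nonneg (by norm_num : (0 : ℝ) ≤ 4)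
    (sin_half_nonneg (n := angleIndex j - angleIndex i) ?_ ?_))
    (sin_half_nonneg (n := angleIndex k - angleIndex j) ?_ ?_))
    (sin_half_nonneg (n := angleIndex k - angleIndex i) ?_ ?_)
  have hgt := fun h1 h2 => mul_pos (mul_pos (mul_pos (by norm_num : (0 : ℝ) < 4)
    (sin_half_pos (n := angleIndex j - angleIndex i) h1 ?_))
    (sin_half_pos (n := angleIndex k - angleIndex j) h2 ?_))
    (sin_half_pos (n := angleIndex k - angleIndex i) ?_ ?_)
  rw [stadium, stadium, stadium, orient_circlePoint]
  push_cast at hge hgt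
  generalize 4 * sin ((angleIndex j - angleIndex i) * step / 2)
    * sin ((angleIndex k - angleIndex j) * step / 2)
    * sin ((angleIndex k - angleIndex i) * step / 2) = X at *
  unfold centerX
  by_cases hLi : IsLeft i <;> by_cases hLj : IsLeft j <;> by_cases hLk : IsLeft k <;>
    simp only [hLi, hLj, hLk, if_true, if_false]
  · have := hgt (by unfold angleIndex IsLeft at *; grind) (by unfold angleIndex IsLeft at *; grind)
    linarith
  · have := sin_step_lt_of_left (i := angleIndex i) (j := angleIndex j)
      (by unfold angleIndex IsLeft at *; grind) (by unfold angleIndex IsLeft at *; grind)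
      (by unfold angleIndex IsLeft at *; grind)
    linarith
  · unfold IsLeft at *; lia
  · have := sin_step_lt_of_right (i := angleIndex j - 1420) (j := angleIndex k - 1420)
      (by unfold angleIndex IsLeft at *; grind) (by unfold angleIndex IsLeft at *; grind)
      (by unfold angleIndex IsLeft at *; grind)
    rw [sin_sub_turn, sin_sub_turn] at this
    linarith
  · have := sin_step_lt_of_left (i := angleIndex j) (j := angleIndex k)
      (by unfold angleIndex IsLeft at *; grind) (by unfold angleIndex IsLeft at *; grind)
      (by unfold angleIndex IsLeft at *; grind)
    linarith
  · have := sin_step_lt_of_right (i := angleIndex k - 1420) (j := angleIndex i)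
      (by unfold angleIndex IsLeft at *; grind) (by unfold angleIndex IsLeft at *; grind)
      (by unfold angleIndex IsLeft at *; grind)
    rw [sin_sub_turn] at this
    linarith
  · have := sin_step_lt_of_right (i := angleIndex i) (j := angleIndex j)
      (by unfold angleIndex IsLeft at *; grind) (by unfold angleIndex IsLeft at *; grind)
      (by unfold angleIndex IsLeft at *; grind)
    linarith
  · have := hgt (by unfold angleIndex IsLeft at *; grind) (by unfold angleIndex IsLeft at *; grind)
    linarith
  all_goals unfold angleIndex; grind

theorem cos_angleIndex_nonpos {i : ℤ} (hi : IsLeft i) : cos (angleIndex i * step) ≤ 0 := by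
  have hs := step_pos
  have h1 : (355 : ℝ) ≤ angleIndex i := by
    exact_mod_cast (by unfold angleIndex IsLeft at *; grind : 355 ≤ angleIndex i)
  have h2 : (angleIndex i : ℝ) ≤ 1065 := by
    exact_mod_cast (by unfold angleIndex IsLeft at *; grind : angleIndex i ≤ 1065)
  apply cos_nonpos_of_pi_div_two_le_of_le <;> rw [pi_eq_mul_step] <;> nlinarith

theorem cos_angleIndex_nonneg {i : ℤ} (hi : ¬IsLeft i) (h0 : -710 ≤ i) (h1 : i ≤ 711) :
    0 ≤ cos (angleIndex i * step) := by
  have hs := step_pos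
  have key : ∀ k : ℤ, -355 ≤ k → k ≤ 355 → 0 ≤ cos (k * step) := by
    intro k hk hk'
    have hk : (-355 : ℝ) ≤ k := by exact_mod_cast hk
    have hk' : (k : ℝ) ≤ 355 := by exact_mod_cast hk'
    apply cos_nonneg_of_neg_pi_div_two_le_of_le <;> rw [pi_eq_mul_step] <;> nlinarith
  by_cases h : i ≤ -130
  · exact key _ (by unfold angleIndex; grind) (by unfold angleIndex; grind)
  · rw [← cos_sub_turn]
    exact key _ (by unfold angleIndex IsLeft at *; grind) (by unfold angleIndex IsLeft at *; grind)

/-! ### Empty circles -/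

theorem dist_circlePoint_center (a c : ℝ) (k : ℤ) :
    dist (circlePoint a k) !₂[c, 0] ^ 2 = 1 + 2 * (a - c) * cos (k * step) + (a - c) ^ 2 := by
  rw [dist_sq]
  simp
  linear_combination sin_sq_add_cos_sq (k * step)

/-- The set of vertices of the stadium. -/
noncomputable def stadiumSet : Finset Plane := (Finset.Icc (-710) 711).image stadium

/-- The vertices in `t` lie on a circle enclosing no vertex of the stadium. -/
def OnEmptyCircle (t : Finset Plane) : Prop :=
  ∃ S : EuclideanGeometry.Sphere Plane, (∀ v ∈ t, v ∈ S) ∧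
    ∀ p ∈ stadiumSet, S.radius ≤ dist p S.center

theorem onEmptyCircle_of_sq {t : Finset Plane} (c r : ℝ)
    (ht : ∀ v ∈ t, dist v !₂[c, 0] ^ 2 = r)
    (hP : ∀ i, -710 ≤ i → i ≤ 711 → r ≤ dist (stadium i) !₂[c, 0] ^ 2) : OnEmptyCircle t := by
  refine ⟨⟨!₂[c, 0], √r⟩, fun v hv => ?_, fun p hp => ?_⟩
  · rw [EuclideanGeometry.mem_sphere, ← ht v hv, sqrt_sq dist_nonneg]
  · obtain ⟨i, hi, rfl⟩ := Finset.mem_image.1 hp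
    rw [Finset.mem_Icc] at hi
    exact sqrt_le_iff.2 ⟨dist_nonneg, hP i hi.1 hi.2⟩

/-- The circle is the one carrying the left semicircle; vertices of the right one have nonnegative
cosine, so moving their centre to the right takes them no closer. -/
theorem onEmptyCircle_left {t : Finset Plane} (ht : ∀ v ∈ t, ∃ i, IsLeft i ∧ v = stadium i) :
    OnEmptyCircle t := by
  refine onEmptyCircle_of_sq (-(3 / 20)) 1 ?_ ?_
  · intro v hv
    obtain ⟨i, hi, rfl⟩ := ht v hv
    rw [stadium, dist_circlePoint_center, centerX, if_pos hi]
    ring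
  · intro i h0 h1
    rw [stadium, dist_circlePoint_center, centerX]
    split_ifs with hi
    · norm_num
    · have := cos_angleIndex_nonneg hi h0 h1
      linarith

theorem onEmptyCircle_right {t : Finset Plane} (ht : ∀ v ∈ t, ∃ i, ¬IsLeft i ∧ v = stadium i) :
    OnEmptyCircle t := by
  refine onEmptyCircle_of_sq (3 / 20) 1 ?_ ?_
  · intro v hv
    obtain ⟨i, hi, rfl⟩ := ht v hv
    rw [stadium, dist_circlePoint_center, centerX, if_neg hi]
    ring
  · intro i h0 h1
    rw [stadium, dist_circlePoint_center, centerX]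
    split_ifs with hi
    · have := cos_angleIndex_nonpos hi
      linarith
    · norm_num

theorem cos_quarter : cos (355 * step) = 0 := by
  rw [← cos_pi_div_two, pi_eq_mul_step]; congr 1; ring

theorem sin_quarter : sin (355 * step) = 1 := by
  rw [← sin_pi_div_two, pi_eq_mul_step]; congr 1; ring

theorem cos_three_quarters : cos (1065 * step) = 0 := by
  rw [← neg_eq_zero, ← cos_sub_pi, ← cos_pi_div_two, pi_eq_mul_step]; congr 1; ring

theorem sin_three_quarters : sin (1065 * step) = -1 := by
  rw [← neg_inj, ← sin_sub_pi, neg_neg, ← sin_pi_div_two, pi_eq_mul_step]; congr 1; ring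

/-- The four tangency points form a rectangle centred at the origin. All other vertices bulge
outwards from it, so they are at least as far from the origin. -/
theorem onEmptyCircle_middle {t : Finset Plane}
    (ht : ∀ v ∈ t, ∃ i ∈ ({-130, -129, 581, 582} : Finset ℤ), v = stadium i) :
    OnEmptyCircle t := by
  refine onEmptyCircle_of_sq 0 (1 + (3 / 20) ^ 2) ?_ ?_
  · intro v hv
    obtain ⟨i, hi, rfl⟩ := ht v hv
    rw [stadium, dist_circlePoint_center]
    simp only [Finset.mem_insert, Finset.mem_singleton] at hi
    rcases hi with rfl | rfl | rfl | rfl <;>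
      norm_num [angleIndex, centerX, IsLeft, cos_quarter, cos_three_quarters]
  · intro i h0 h1
    rw [stadium, dist_circlePoint_center, centerX]
    split_ifs with hi
    · have := cos_angleIndex_nonpos hi
      linarith
    · have := cos_angleIndex_nonneg hi h0 h1
      linarith

/-! ### The potential and the edges that respect it -/

/-- The length of an edge between consecutive points of a semicircle. -/
noncomputable def arcEdge : ℝ := 2 * sin (step / 2)

theorem arcEdge_pos : 0 < arcEdge := by
  have := sin_half_pos (n := 1) (by norm_num) (by norm_num)
  simp only [Int.cast_one, one_mul] at this
  unfold arcEdge
  positivity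

theorem arcEdge_le_step : arcEdge ≤ step := by
  have := sin_le (by linarith [step_pos] : 0 ≤ step / 2)
  unfold arcEdge
  linarith

/-- The length of the part of the boundary of the stadium from vertex `0` to vertex `i` on the side
of `i`. -/
noncomputable def potential (i : ℤ) : ℝ :=
  |(angleIndex i : ℝ) - 484| * arcEdge + if IsLeft i then 0 else 3 / 10

theorem dist_circlePoint (c : ℝ) {i j : ℤ} (hij : i ≤ j) (hj : j - i < 1420) :
    dist (circlePoint c i) (circlePoint c j) = 2 * sin ((j - i : ℤ) * step / 2) := by
  have h := sin_half_nonneg (n := j - i) (by lia) hj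
  rw [← sq_eq_sq₀ dist_nonneg (by positivity), dist_sq]
  simp only [circlePoint_zero, circlePoint_one]
  have e : cos (j * step - i * step) = 1 - 2 * sin ((j - i : ℤ) * step / 2) ^ 2 := by
    rw [← cos_two_mul_eq_one_sub]
    congr 1
    push_cast
    ring
  rw [cos_sub] at e
  linear_combination -2 * e + sin_sq_add_cos_sq (i * step) + sin_sq_add_cos_sq (j * step)

/-- The difference of the potentials of two vertices is at most their distance. -/
def IsShort (i j : ℤ) : Prop := |potential i - potential j| ≤ dist (stadium i) (stadium j)

theorem IsShort.symm {i j : ℤ} (h : IsShort i j) : IsShort j i := by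
  unfold IsShort at *
  rwa [abs_sub_comm, dist_comm]

theorem isShort_self (i : ℤ) : IsShort i i := by simp [IsShort]

theorem arcEdge_le_chord {n : ℤ} (h0 : 1 ≤ n) (h1 : n ≤ 1419) :
    arcEdge ≤ 2 * sin (n * step / 2) := by
  have hs := step_pos
  have key : ∀ m : ℤ, 1 ≤ m → m ≤ 710 → arcEdge ≤ 2 * sin (m * step / 2) := by
    intro m hm hm'
    have hm : (1 : ℝ) ≤ m := by exact_mod_cast hm
    have hm' : (m : ℝ) ≤ 710 := by exact_mod_cast hm'
    unfold arcEdge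
    gcongr
    apply monotoneOn_sin <;> (try constructor) <;> (try rw [pi_eq_mul_step]) <;> nlinarith
  rcases le_or_gt n 710 with h | h
  · exact key n h0 h
  · have := key (1420 - n) (by lia) (by lia)
    rwa [show ((1420 - n : ℤ) : ℝ) * step / 2 = π - n * step / 2 by
      rw [pi_eq_mul_step]; push_cast; ring, sin_pi_sub] at this

/-- With w = (226 − m/2) · `step` in [0, 1], the chord is 2 cos w ≥ 2 − w², while m · `step` = 452 ·
`step` − 2w ≤ 2 − 2w. -/
theorem mul_arcEdge_le_chord {m : ℤ} (h0 : 0 ≤ m) (h1 : m ≤ 452) :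
    m * arcEdge ≤ 2 * sin ((m + 258 : ℤ) * step / 2) := by
  have hs := step_pos
  have h0' : (0 : ℝ) ≤ m := by exact_mod_cast h0
  have h1' : (m : ℝ) ≤ 452 := by exact_mod_cast h1
  -- This is π ≤ 355/113.
  have hle : 226 * step ≤ 1 := by
    unfold step
    linarith [pi_lt_d20]
  have e : ((m + 258 : ℤ) : ℝ) * step / 2 = π / 2 - (226 - m / 2) * step := by
    rw [pi_eq_mul_step]; push_cast; ring
  rw [e, sin_pi_div_two_sub]
  have hcos := one_sub_sq_div_two_le_cos (x := (226 - m / 2) * step)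
  have hw0 : 0 ≤ (226 - m / 2) * step := by
    apply mul_nonneg _ hs.le
    linarith
  have hw1 : (226 - m / 2) * step ≤ 1 := by nlinarith
  have hm : m * arcEdge ≤ m * step := by gcongr; exact arcEdge_le_step
  nlinarith

theorem mul_arcEdge_le_chord' {m : ℤ} (h0 : 0 ≤ m) (h1 : m ≤ 452) :
    m * arcEdge ≤ 2 * sin ((1162 - m : ℤ) * step / 2) := by
  have := mul_arcEdge_le_chord h0 h1
  rwa [show ((m + 258 : ℤ) : ℝ) * step / 2 = π - (1162 - m : ℤ) * step / 2 by
      rw [pi_eq_mul_step]; push_cast; ring, sin_pi_sub] at this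

/-- Two vertices of the same semicircle whose distance along the circle is `n` steps and whose
distances from the base vertex differ by `m` steps. -/
theorem isShort_of_chord {i j m n : ℤ} (hij : IsLeft i ↔ IsLeft j)
    (hm : |angleIndex i - 484| - |angleIndex j - 484| = m ∨
      |angleIndex i - 484| - |angleIndex j - 484| = -m)
    (hn : angleIndex j - angleIndex i = n) (hn0 : 0 ≤ n)
    (hn1 : n < 1420) (h : |(m : ℝ)| * arcEdge ≤ 2 * sin (n * step / 2)) : IsShort i j := by
  subst hn
  have hc : centerX j = centerX i := by simp [centerX, hij]
  have hd : dist (stadium i) (stadium j) =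
      2 * sin ((angleIndex j - angleIndex i : ℤ) * step / 2) := by
    rw [stadium, stadium, hc]
    exact dist_circlePoint _ (by lia) hn1
  rw [IsShort, hd]
  refine le_trans (le_of_eq ?_) h
  have : potential i - potential j
      = ((|angleIndex i - 484| - |angleIndex j - 484| : ℤ) : ℝ) * arcEdge := by
    simp only [potential, hij]
    push_cast
    ring
  rw [this, abs_mul, abs_of_pos arcEdge_pos]
  rcases hm with hm | hm <;> simp [hm]

theorem isShort_of_chord_one {i j : ℤ} (hij : IsLeft i ↔ IsLeft j)
    (hm : |(|angleIndex i - 484| - |angleIndex j - 484|)| ≤ 1)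
    (hn0 : 1 ≤ angleIndex j - angleIndex i) (hn1 : angleIndex j - angleIndex i ≤ 1419) :
    IsShort i j := by
  refine isShort_of_chord hij (Or.inl rfl) rfl (by lia) (by lia) ?_
  refine le_trans ?_ (arcEdge_le_chord hn0 hn1)
  refine mul_le_of_le_one_left arcEdge_pos.le ?_
  exact_mod_cast hm

theorem isShort_step_up {i : ℤ} (h0 : -710 ≤ i) (h1 : i + 1 ≤ 711) : IsShort i (i + 1) := by
  by_cases h : i = -130 ∨ i = 581
  · have hd : dist (stadium i) (stadium (i + 1)) = 3 / 10 := by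
      rw [← sq_eq_sq₀ dist_nonneg (by norm_num), dist_sq]
      rcases h with rfl | rfl <;> norm_num [stadium, angleIndex, centerX, IsLeft]
    rw [IsShort, hd]
    rcases h with rfl | rfl <;> norm_num [potential, angleIndex, IsLeft]
  · apply isShort_of_chord_one <;> simp only [angleIndex, IsLeft] <;> grind

/-- The ends are |i| and |j| steps from vertex 0 on opposite sides, so their potentials differ by at
most one arc edge, and no chord between distinct points of a semicircle is shorter. -/
theorem isShort_zigzag_left {i j : ℤ} (hi : -129 ≤ i) (hi0 : i ≤ 0) (hj : 0 < j) (hj1 : j ≤ 129)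
    (h : |i + j| ≤ 1) : IsShort i j := by
  apply isShort_of_chord_one <;> simp only [angleIndex, IsLeft] <;> grind

theorem isShort_zigzag_right {i j : ℤ} (hi : -710 ≤ i) (hi0 : i ≤ -582) (hj : 582 ≤ j)
    (hj1 : j ≤ 711) (h : |i + j| ≤ 1) : IsShort i j := by
  apply isShort_of_chord_one <;> simp only [angleIndex, IsLeft] <;> grind

/-- The apex -129 is the upper left tangency point, with the same potential as vertex 129. At `j =
581` the edge is a diameter, the critical case. -/
theorem isShort_fan_left {j : ℤ} (hj : 129 ≤ j) (hj1 : j ≤ 581) : IsShort (-129) j := by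
  refine isShort_of_chord (m := j - 129) (n := j - 129 + 258) ?_ ?_ ?_ (by lia) (by lia) ?_
  · unfold IsLeft; grind
  · unfold angleIndex; grind
  · unfold angleIndex; grind
  · rw [abs_of_nonneg (by exact_mod_cast (by lia : 0 ≤ j - 129))]
    exact mul_arcEdge_le_chord (by lia) (by lia)

theorem isShort_fan_right {i : ℤ} (hi : -582 ≤ i) (hi1 : i ≤ -130) : IsShort i 582 := by
  refine isShort_of_chord (m := i + 582) (n := 1162 - (i + 582)) ?_ ?_ ?_ (by lia) (by lia) ?_
  · unfold IsLeft; grind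
  · unfold angleIndex; grind
  · unfold angleIndex; grind
  · rw [abs_of_nonneg (by exact_mod_cast (by lia : 0 ≤ i + 582))]
    exact mul_arcEdge_le_chord' (by lia) (by lia)

/-- The two straight sides lie on opposite routes, so here 3/10 is subtracted from the 452 arc
edges, while the diagonal is longer than 2. -/
theorem isShort_diagonal : IsShort (-130) 581 := by
  have hd : dist (stadium (-130)) (stadium 581) ^ 2 = 4 + 9 / 100 := by
    rw [dist_sq]
    norm_num [stadium, angleIndex, centerX, IsLeft, cos_quarter, cos_three_quarters, sin_quarter,
      sin_three_quarters]
  have hd2 : 2 ≤ dist (stadium (-130)) (stadium 581) := by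
    nlinarith [dist_nonneg (x := stadium (-130)) (y := stadium 581)]
  have ha := arcEdge_pos
  have hb := mul_arcEdge_le_chord (m := 452) (by norm_num) (by norm_num)
  have hc := sin_le_one ((452 + 258 : ℤ) * step / 2)
  refine le_trans ?_ hd2
  norm_num [potential, angleIndex, IsLeft] at *
  rw [abs_le]
  constructor <;> linarith

/-! ### Numerical estimate of the ratio -/

/-- At `x` itself the Taylor error is too large; at x/16 it is small enough to survive four
applications of the double-angle formula. -/
theorem cos_le_of_bounds {x : ℝ} (h0 : 0.9999999 ≤ x) (h1 : x ≤ 1) : cos x ≤ 0.5404 := by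
  have dbl : ∀ {y c c' : ℝ}, 0 ≤ y → y ≤ 1 → cos y ≤ c → 2 * c ^ 2 - 1 ≤ c' → cos (2 * y) ≤ c' := by
    intro y c c' hy hy1 hc hc'
    have : 0 ≤ cos y := cos_nonneg_of_neg_pi_div_two_le_of_le (by linarith [pi_pos])
      (by linarith [pi_gt_three])
    rw [cos_two_mul]
    nlinarith
  have hb := (abs_sub_le_iff.1 (cos_bound (x := x / 16)
    (by rw [abs_le]; constructor <;> linarith))).1
  rw [abs_of_nonneg (by linarith)] at hb
  have h4 : cos (x / 16) ≤ 0.9980477 := by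
    have l2 : (0.0624999 : ℝ) ^ 2 ≤ (x / 16) ^ 2 := by gcongr; linarith
    have l4 : (x / 16) ^ 4 ≤ (0.0625 : ℝ) ^ 4 := by gcongr; linarith
    norm_num at l2 l4 ⊢
    linarith
  have h3 := dbl (c' := 0.992199) (by linarith) (by linarith) h4 (by norm_num)
  have h2 := dbl (c' := 0.968918) (by linarith) (by linarith) h3 (by norm_num)
  have h1 := dbl (c' := 0.877605) (by linarith) (by linarith) h2 (by norm_num)
  have h0 := dbl (c' := 0.5404) (by linarith) (by linarith) h1 (by norm_num)
  convert h0 using 2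
  ring

/-- Vertices 0 and 711 are opposite through the origin, at angle 226 · `step` to the long axis,
within 10⁻⁷ of 1 radian. The separation 3/10 is near the maximiser, about 0.294, of (π + d)² / (4 +
d² + 4d cos 1). -/
theorem ratio_mul_dist_le :
    1.5810 * dist (stadium 0) (stadium 711) ≤ potential 711 - potential 0 := by
  have hs := step_pos
  have hpot : potential 711 - potential 0 = 710 * arcEdge + 3 / 10 := by
    norm_num [potential, angleIndex, IsLeft]
  have hc : cos (226 * step) ≤ 0.5404 := by
    apply cos_le_of_bounds <;> unfold step <;> linarith [pi_lt_d20, pi_gt_d20]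
  have hd : dist (stadium 0) (stadium 711) ^ 2 = 4 + 9 / 100 + 6 / 5 * cos (226 * step) := by
    have e1 : (1194 : ℝ) * step = π + 484 * step := by rw [pi_eq_mul_step]; ring
    have e2 : (484 : ℝ) * step = π - 226 * step := by rw [pi_eq_mul_step]; ring
    rw [dist_sq]
    norm_num [stadium, angleIndex, centerX, IsLeft]
    rw [e1, e2, show π + (π - 226 * step) = 2 * π - 226 * step by ring, cos_two_pi_sub,
      sin_two_pi_sub, cos_pi_sub, sin_pi_sub]
    linear_combination 4 * sin_sq_add_cos_sq (226 * step)
  have hd2 : dist (stadium 0) (stadium 711) ≤ 2.176806 := by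
    refine (sq_le_sq₀ dist_nonneg (by norm_num)).1 ?_
    rw [hd]
    norm_num at hc ⊢
    linarith
  have ha : 3.14158 ≤ 710 * arcEdge := by
    have h := sin_gt_sub_cube (x := step / 2) (by positivity)
    have hu : step ≤ 1 / 200 := by unfold step; linarith [pi_lt_d2]
    have h3 : (step / 2) ^ 3 ≤ (1 / 400 : ℝ) ^ 3 :=
      pow_le_pow_left₀ (by positivity) (by linarith) 3
    have hl : 3.141592 ≤ 710 * step := by rw [← pi_eq_mul_step]; exact pi_gt_d6.le
    unfold arcEdge
    norm_num at h3 hl ⊢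
    linarith
  rw [hpot]
  norm_num at ha hd2 ⊢
  linarith

/-! ### Assembling the triangulation -/

/-- The vertices in `t` lie on an empty circle, and any two of them differ in potential by at most
their distance. -/
def IsShortAndEmpty (f : Plane → ℝ) (t : Finset Plane) : Prop :=
  OnEmptyCircle t ∧ ∀ u ∈ t, ∀ v ∈ t, |f u - f v| ≤ dist u v

theorem IsShortAndEmpty.mono {f : Plane → ℝ} (s t : Finset Plane) (hst : s ⊆ t)
    (h : IsShortAndEmpty f t) : IsShortAndEmpty f s := by
  obtain ⟨⟨S, hS, hP⟩, hf⟩ := h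
  exact ⟨⟨S, fun v hv => hS v (hst hv), hP⟩, fun u hu v hv => hf u (hst hu) v (hst hv)⟩

theorem isShortAndEmpty_triple {f : Plane → ℝ}
    (hf : ∀ i, -710 ≤ i → i ≤ 711 → f (stadium i) = potential i)
    {i j k : ℤ} (hi : -710 ≤ i ∧ i ≤ 711) (hj : -710 ≤ j ∧ j ≤ 711)
    (hk : -710 ≤ k ∧ k ≤ 711) (hij : IsShort i j) (hik : IsShort i k) (hjk : IsShort j k)
    (h : (IsLeft i ∧ IsLeft j ∧ IsLeft k) ∨ (¬IsLeft i ∧ ¬IsLeft j ∧ ¬IsLeft k) ∨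
      ∀ l, l = i ∨ l = j ∨ l = k → l ∈ ({-130, -129, 581, 582} : Finset ℤ)) :
    IsShortAndEmpty f {stadium i, stadium j, stadium k} := by
  constructor
  · rcases h with ⟨h1, h2, h3⟩ | ⟨h1, h2, h3⟩ | h
    · apply onEmptyCircle_left
      intro v hv
      simp only [Finset.mem_insert, Finset.mem_singleton] at hv
      rcases hv with rfl | rfl | rfl
      exacts [⟨i, h1, rfl⟩, ⟨j, h2, rfl⟩, ⟨k, h3, rfl⟩]
    · apply onEmptyCircle_right
      intro v hv
      simp only [Finset.mem_insert, Finset.mem_singleton] at hv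
      rcases hv with rfl | rfl | rfl
      exacts [⟨i, h1, rfl⟩, ⟨j, h2, rfl⟩, ⟨k, h3, rfl⟩]
    · apply onEmptyCircle_middle
      intro v hv
      simp only [Finset.mem_insert, Finset.mem_singleton] at hv
      rcases hv with rfl | rfl | rfl
      exacts [⟨i, h i (by simp), rfl⟩, ⟨j, h j (by simp), rfl⟩, ⟨k, h k (by simp), rfl⟩]
  · have fi := hf i hi.1 hi.2
    have fj := hf j hj.1 hj.2
    have fk := hf k hk.1 hk.2
    intro u hu v hv
    simp only [Finset.mem_insert, Finset.mem_singleton] at hu hv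
    rcases hu with rfl | rfl | rfl <;> rcases hv with rfl | rfl | rfl <;>
      simp only [fi, fj, fk]
    exacts [isShort_self i, hij, hik, hij.symm, isShort_self j, hjk, hik.symm, hjk.symm,
      isShort_self k]

theorem HasTriangulation.stadium_up {f : Plane → ℝ}
    (hf : ∀ i, -710 ≤ i → i ≤ 711 → f (stadium i) = potential i)
    {l u : ℤ}
    (h : HasTriangulation stadium (IsShortAndEmpty f) l u) (hl : -710 ≤ l) (hlu : l < u)
    (hu : u + 1 ≤ 711) (h1 : IsShort l u) (h2 : IsShort l (u + 1))
    (h3 : (IsLeft l ∧ IsLeft u ∧ IsLeft (u + 1)) ∨ (¬IsLeft l ∧ ¬IsLeft u ∧ ¬IsLeft (u + 1)) ∨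
      ∀ k, k = l ∨ k = u ∨ k = u + 1 → k ∈ ({-130, -129, 581, 582} : Finset ℤ)) :
    HasTriangulation stadium (IsShortAndEmpty f) l (u + 1) :=
  h.step_up IsShortAndEmpty.mono isConvexChain_stadium hl hlu hu <|
    isShortAndEmpty_triple hf (by lia) (by lia) (by lia) h1 h2 (isShort_step_up (by lia) hu) h3

theorem HasTriangulation.stadium_down {f : Plane → ℝ}
    (hf : ∀ i, -710 ≤ i → i ≤ 711 → f (stadium i) = potential i)
    {l u : ℤ}
    (h : HasTriangulation stadium (IsShortAndEmpty f) l u) (hl : -710 ≤ l - 1) (hlu : l < u)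
    (hu : u ≤ 711) (h1 : IsShort l u) (h2 : IsShort (l - 1) u)
    (h3 : (IsLeft l ∧ IsLeft u ∧ IsLeft (l - 1)) ∨ (¬IsLeft l ∧ ¬IsLeft u ∧ ¬IsLeft (l - 1)) ∨
      ∀ k, k = l ∨ k = u ∨ k = l - 1 → k ∈ ({-130, -129, 581, 582} : Finset ℤ)) :
    HasTriangulation stadium (IsShortAndEmpty f) (l - 1) u := by
  refine h.step_down IsShortAndEmpty.mono isConvexChain_stadium hl hlu hu <|
    isShortAndEmpty_triple hf (by lia) (by lia) (by lia) h1 ?_ h2.symm h3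
  have := isShort_step_up hl (by lia)
  rw [sub_add_cancel] at this
  exact this.symm

theorem hasTriangulation_zigzag_left {f : Plane → ℝ}
    (hf : ∀ i, -710 ≤ i → i ≤ 711 → f (stadium i) = potential i)
    (n : ℕ) (hn : n ≤ 128) :
    HasTriangulation stadium (IsShortAndEmpty f) (-n) (n + 1) := by
  induction n with
  | zero =>
    have hne : stadium 0 ≠ stadium (0 + 1) := fun h => by
      have := (isConvexChain_stadium.injOn (by norm_num)) (by norm_num) (by norm_num) h
      norm_num at this
    refine HasTriangulation.of_edge IsShortAndEmpty.mono (by simpa using hne) ?_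
    -- The starting edge is treated as a degenerate triple with its last vertex repeated.
    have := isShortAndEmpty_triple hf (i := 0) (j := 1) (k := 1) (by norm_num) (by norm_num)
      (by norm_num) (isShort_step_up (by norm_num) (by norm_num))
      (isShort_step_up (by norm_num) (by norm_num)) (isShort_self 1) (by simp [IsLeft])
    simpa using this
  | succ n ih =>
    have h1 := (ih (by lia)).stadium_down hf (by lia) (by lia) (by lia)
      (isShort_zigzag_left (by lia) (by lia) (by lia) (by lia) (by grind))
      (isShort_zigzag_left (by lia) (by lia) (by lia) (by lia) (by grind))
      (by unfold IsLeft; grind)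
    have h2 := h1.stadium_up hf (by lia) (by lia) (by lia)
      (isShort_zigzag_left (by lia) (by lia) (by lia) (by lia) (by grind))
      (isShort_zigzag_left (by lia) (by lia) (by lia) (by lia) (by grind))
      (by unfold IsLeft; grind)
    convert h2 using 1 <;> push_cast <;> ring

theorem hasTriangulation_fan_left {f : Plane → ℝ}
    (hf : ∀ i, -710 ≤ i → i ≤ 711 → f (stadium i) = potential i)
    (n : ℕ) (hn : n ≤ 452) :
    HasTriangulation stadium (IsShortAndEmpty f) (-129) (129 + n) := by
  induction n with
  | zero =>
    have h := (hasTriangulation_zigzag_left hf 128 le_rfl).stadium_down hf (by norm_num)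
      (by norm_num) (by norm_num)
      (isShort_zigzag_left (by norm_num) (by norm_num) (by norm_num) (by norm_num) (by norm_num))
      (isShort_zigzag_left (by norm_num) (by norm_num) (by norm_num) (by norm_num) (by norm_num))
      (by norm_num [IsLeft])
    norm_num at h ⊢
    exact h
  | succ n ih =>
    have h := (ih (by lia)).stadium_up hf (by lia) (by lia) (by lia)
      (isShort_fan_left (by lia) (by lia)) (isShort_fan_left (by lia) (by lia))
      (by unfold IsLeft; grind)
    convert h using 1
    push_cast
    ring

theorem hasTriangulation_fan_right {f : Plane → ℝ}
    (hf : ∀ i, -710 ≤ i → i ≤ 711 → f (stadium i) = potential i)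
    (n : ℕ) (hn : n ≤ 452) :
    HasTriangulation stadium (IsShortAndEmpty f) (-130 - n) 582 := by
  induction n with
  | zero =>
    have h0 := hasTriangulation_fan_left hf 452 le_rfl
    norm_num at h0
    -- The two triangles of the middle rectangle, separated by the diagonal from -130 to 581.
    have h1 := h0.stadium_down hf (by norm_num) (by norm_num) (by norm_num)
      (isShort_fan_left (by norm_num) (by norm_num)) (by simpa using isShort_diagonal)
      (by right; right; rintro k (rfl | rfl | rfl) <;> simp)
    norm_num at h1
    have h2 := h1.stadium_up hf (by norm_num) (by norm_num) (by norm_num) isShort_diagonal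
      (by simpa using isShort_fan_right (i := -130) (by norm_num) (by norm_num))
      (by right; right; rintro k (rfl | rfl | rfl) <;> simp)
    norm_num at h2 ⊢
    exact h2
  | succ n ih =>
    have h := (ih (by lia)).stadium_down hf (by lia) (by lia) (by lia)
      (isShort_fan_right (by lia) (by lia)) (isShort_fan_right (by lia) (by lia))
      (by unfold IsLeft; grind)
    convert h using 1
    push_cast
    ring

theorem hasTriangulation_zigzag_right {f : Plane → ℝ}
    (hf : ∀ i, -710 ≤ i → i ≤ 711 → f (stadium i) = potential i)
    (n : ℕ) (hn : n ≤ 128) :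
    HasTriangulation stadium (IsShortAndEmpty f) (-582 - n) (582 + n) := by
  induction n with
  | zero =>
    have h := hasTriangulation_fan_right hf 452 le_rfl
    norm_num at h ⊢
    exact h
  | succ n ih =>
    have h1 := (ih (by lia)).stadium_up hf (by lia) (by lia) (by lia)
      (isShort_zigzag_right (by lia) (by lia) (by lia) (by lia) (by grind))
      (isShort_zigzag_right (by lia) (by lia) (by lia) (by lia) (by grind))
      (by unfold IsLeft; grind)
    have h2 := h1.stadium_down hf (by lia) (by lia) (by lia)
      (isShort_zigzag_right (by lia) (by lia) (by lia) (by lia) (by grind))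
      (isShort_zigzag_right (by lia) (by lia) (by lia) (by lia) (by grind))
      (by unfold IsLeft; grind)
    convert h2 using 1 <;> push_cast <;> ring

theorem hasTriangulation_stadium {f : Plane → ℝ}
    (hf : ∀ i, -710 ≤ i → i ≤ 711 → f (stadium i) = potential i) :
    HasTriangulation stadium (IsShortAndEmpty f) (-710) 711 := by
  have h0 := hasTriangulation_zigzag_right hf 128 le_rfl
  norm_num at h0
  exact h0.stadium_up hf (by norm_num) (by norm_num) (by norm_num)
    (isShort_zigzag_right (by norm_num) (by norm_num) (by norm_num) (by norm_num) (by norm_num))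
    (isShort_zigzag_right (by norm_num) (by norm_num) (by norm_num) (by norm_num) (by norm_num))
    (by norm_num [IsLeft])

end DelaunayDilation

theorem theorem1 :
    ∃ (P : Finset DelaunayDilation.Plane)
      (K : Geometry.SimplicialComplex ℝ DelaunayDilation.Plane),
      DelaunayDilation.InConvexPosition P ∧
      DelaunayDilation.IsDelaunayTriangulation P K ∧
      ENNReal.ofReal 1.5810 ≤ DelaunayDilation.dilation (DelaunayDilation.edgeGraph P K) := by
  open DelaunayDilation in
  have hinj := isConvexChain_stadium.injOn (by norm_num)
  -- The potential is indexed by integers; injectivity of `stadium` on the index range transports it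
  -- to points.
  let f : Plane → ℝ := potential ∘ Function.invFunOn stadium (Set.Icc (-710) 711)
  have hf : ∀ i, -710 ≤ i → i ≤ 711 → f (stadium i) = potential i := fun i h0 h1 =>
    congrArg potential (hinj.leftInvOn_invFunOn ⟨h0, h1⟩)
  obtain ⟨K, hK, -, hQ⟩ := hasTriangulation_stadium hf
  refine ⟨stadiumSet, K, isConvexChain_stadium.inConvexPosition (by norm_num),
    hK.isDelaunayTriangulation fun t ht => (hQ t ht).1, ?_⟩
  have hmem : ∀ i : ℤ, -710 ≤ i → i ≤ 711 → stadium i ∈ stadiumSet := fun i h0 h1 =>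
    Finset.mem_image_of_mem _ (Finset.mem_Icc.2 ⟨h0, h1⟩)
  refine ofReal_le_dilation (f := fun x => f x)
    (p := ⟨stadium 0, hmem 0 (by norm_num) (by norm_num)⟩)
    (q := ⟨stadium 711, hmem 711 (by norm_num) (by norm_num)⟩) ?_ ?_ (by norm_num) ?_
  · rintro x y ⟨-, e, he, hxy⟩
    have hx : (x : Plane) ∈ e := by rw [← Finset.mem_coe, hxy]; simp
    have hy : (y : Plane) ∈ e := by rw [← Finset.mem_coe, hxy]; simp
    have := (hQ e he).2 _ hy _ hx
    rw [dist_comm] at this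
    exact (le_abs_self _).trans this
  · intro h
    have := hinj (by norm_num) (by norm_num) (congrArg Subtype.val h)
    norm_num at this
  · simpa only [hf 0 (by norm_num) (by norm_num), hf 711 (by norm_num) (by norm_num),
      Subtype.dist_eq] using ratio_mul_dist_le
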